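/- Let $X$ be a complex Banach space with open unit ball $B$, closed unit ball $\bar B$ and closed bidual ball $\bar B^{**}$. Let $A_u(B)$ be the algebra of uniformly continuous holomorphic functions on $B$, and $A_\infty(B)$ the algebra of bounded holomorphic functions on $B$ that extend continuously to $\bar B$, both with the supremum norm on $B$. Let $P(X)$ be the space of continuous polynomials on $X$, and let $\tilde P$ (resp. $\tilde g$) denote the Aron–Berner extension to $X^{**}$ of $P\in P(X)$ (resp. to $\bar B^{**}$ of $g\in A_u(B)$, extended continuously to the boundary). Let $x\in\bar B$ be a strong peak point for $A_u(B)$ as a function space on $\bar B$ (its elements being extended continuously to $\bar B$): there is $g\in A_u(B)$ with $g(x)=1$ such that for every $\varepsilon>0$ there is $\delta>0$ with $|g(y)|<1-\delta$ for all $y\in\bar B$ with $\|x-y\|>\varepsilon$. Let $H(B)$ be a uniform algebra between $A_u(B)$ and $A_\infty(B)$, i.e. a sup-norm closed subalgebra with $A_u(B)\subset H(B)\subset A_\infty(B)$, and let $M_{H(B)}$ be its spectrum (the nonzero multiplicative linear functionals on $H(B)$). Then the polynomial fiber $$M_x^{\mathcal P}=\{\tau\in M_{H(B)} : \tau(g)=\tilde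 g(x)\ \text{for all } g\in A_u(B)\}$$ consists of exactly one point. Hence the polynomial cluster value theorem for $H(B)$ holds at $x$: for every $f\in H(B)$, with Gelfand transform $\hat f$, $$\{\lambda\in\mathbb C : \text{there is a net } (x_\alpha)\subset B \text{ with } P(x_\alpha)\to\tilde P(x)\ \text{for all } P\in P(X) \text{ and } f(x_\alpha)\to\lambda\}=\hat f(M_x^{\mathcal P}).$$ -/

import Mathlib

open scoped Topology BoundedContinuousFunction

noncomputable section

namespace PolyCVP

section Algebras

variable (X : Type*) [NormedAddCommGroup X]

/-- The open unit ball `B` of `X`. -/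
abbrev UnitBall : Type _ := Metric.ball (0 : X) 1

/-- The closed unit ball of `X`. -/
abbrev ClosedUnitBall : Type _ := Metric.closedBall (0 : X) 1

variable {X}

/-- A point of `B`, viewed as a point of the closed unit ball. -/
def UnitBall.toClosed (y : UnitBall X) : ClosedUnitBall X :=
  ⟨y.1, Metric.ball_subset_closedBall y.2⟩

/-- A function on `B` as a function on `X` (zero off `B`); only its values on the open set `B`
are ever used. -/
def onSpace (f : UnitBall X → ℂ) : X → ℂ := Function.extend Subtype.val f 0

theorem onSpace_apply (f : UnitBall X → ℂ) (y : UnitBall X) : onSpace f y.1 = f y :=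
  Subtype.val_injective.extend_apply f 0 y

theorem uniformContinuous_mul_bdd {f g : UnitBall X →ᵇ ℂ} (hf : UniformContinuous f)
    (hg : UniformContinuous g) : UniformContinuous (fun y => f y * g y) := by
  have h : UniformContinuousOn (fun p : ℂ × ℂ => p.1 * p.2)
      (Metric.closedBall (0 : ℂ) ‖f‖ ×ˢ Metric.closedBall (0 : ℂ) ‖g‖) :=
    ((isCompact_closedBall _ _).prod (isCompact_closedBall _ _)).uniformContinuousOn_of_continuous
      continuous_mul.continuousOn
  have hm : ∀ y, (f y, g y) ∈ Metric.closedBall (0 : ℂ) ‖f‖ ×ˢ Metric.closedBall (0 : ℂ) ‖g‖ :=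
    fun y => ⟨by simpa using f.norm_coe_le_norm y, by simpa using g.norm_coe_le_norm y⟩
  exact (uniformContinuousOn_iff_restrict.1 h).comp ((hf.prodMk hg).subtype_mk hm)

variable [NormedSpace ℂ X]

/-- Holomorphy on `B`: local expansion in convergent series of continuous homogeneous
polynomials. -/
def IsHolo (f : UnitBall X → ℂ) : Prop :=
  AnalyticOnNhd ℂ (onSpace f) (Metric.ball (0 : X) 1)

theorem IsHolo.congr_of {f : UnitBall X → ℂ} {F : X → ℂ}
    (hF : AnalyticOnNhd ℂ F (Metric.ball (0 : X) 1)) (h : ∀ y : UnitBall X, F y.1 = f y) :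
    IsHolo f :=
  hF.congr Metric.isOpen_ball fun y hy => (h ⟨y, hy⟩).trans (onSpace_apply f ⟨y, hy⟩).symm

theorem isHolo_const (c : ℂ) : IsHolo (fun _ : UnitBall X => c) :=
  IsHolo.congr_of (F := fun _ => c) analyticOnNhd_const fun _ => rfl

theorem IsHolo.add {f g : UnitBall X → ℂ} (hf : IsHolo f) (hg : IsHolo g) :
    IsHolo (fun y => f y + g y) :=
  IsHolo.congr_of (AnalyticOnNhd.add hf hg) fun y => by
    simp only [Pi.add_apply, onSpace_apply]

theorem IsHolo.mul {f g : UnitBall X → ℂ} (hf : IsHolo f) (hg : IsHolo g) :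
    IsHolo (fun y => f y * g y) :=
  IsHolo.congr_of (AnalyticOnNhd.mul hf hg) fun y => by
    simp only [onSpace_apply]

variable (X)

/-- `A_u(B)`: the (bounded) holomorphic, uniformly continuous functions on `B`, inside the
Banach algebra of bounded continuous functions on `B` with the supremum norm. -/
def Au : Subalgebra ℂ (UnitBall X →ᵇ ℂ) where
  carrier := {f | IsHolo (f : UnitBall X → ℂ) ∧ UniformContinuous f}
  mul_mem' hf hg := ⟨hf.1.mul hg.1, uniformContinuous_mul_bdd hf.2 hg.2⟩
  add_mem' hf hg := ⟨hf.1.add hg.1, hf.2.add hg.2⟩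
  algebraMap_mem' c := ⟨isHolo_const c, uniformContinuous_const⟩

/-- `A_∞(B)`: the bounded holomorphic functions on `B` that extend continuously to the closed
unit ball. -/
def Ainf : Subalgebra ℂ (UnitBall X →ᵇ ℂ) where
  carrier := {f | IsHolo (f : UnitBall X → ℂ) ∧
    ∃ F : ClosedUnitBall X → ℂ, Continuous F ∧ ∀ y : UnitBall X, F y.toClosed = f y}
  mul_mem' := by
    rintro f g ⟨hf, F, hF, hFf⟩ ⟨hg, G, hG, hGg⟩
    exact ⟨hf.mul hg, fun y => F y * G y, hF.mul hG, fun y => by simp [hFf, hGg]⟩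
  add_mem' := by
    rintro f g ⟨hf, F, hF, hFf⟩ ⟨hg, G, hG, hGg⟩
    exact ⟨hf.add hg, fun y => F y + G y, hF.add hG, fun y => by simp [hFf, hGg]⟩
  algebraMap_mem' c := ⟨isHolo_const c, fun _ => c, continuous_const, fun _ => rfl⟩

/-- `A_u(B)` as a function space on the closed unit ball: each member of `A_u(B)` is replaced by
its continuous extension. -/
def AuClosed : Set (ClosedUnitBall X → ℂ) :=
  {F | Continuous F ∧ ∃ g ∈ Au X, ∀ y : UnitBall X, F y.toClosed = g y}

end Algebras

/-- `x` is a strong peak point for the function space `H` on the metric space `Ω`. -/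
def IsStrongPeakPoint {Ω : Type*} [MetricSpace Ω] (H : Set (Ω → ℂ)) (x : Ω) : Prop :=
  ∃ f ∈ H, f x = 1 ∧ ∀ ε > 0, ∃ δ > 0, ∀ y, ε < dist x y → ‖f y‖ < 1 - δ

section AronBerner

variable {X : Type*} [NormedAddCommGroup X] [NormedSpace ℂ X]

/-- The Arens extension `Ã(z₀, …, zₙ₋₁)` of a continuous `n`-linear form `A` on `X` to the
bidual, as a function of `A`. The variables are extended one at a time by weak-star continuity,
the last one first: `Ã(z₀, z₁, …) = z₀ (x ↦ (A (x, ⋯))~ (z₁, …))`. -/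
def arens : (n : ℕ) → (Fin n → StrongDual ℂ (StrongDual ℂ X)) →
    ContinuousMultilinearMap ℂ (fun _ : Fin n => X) ℂ →L[ℂ] ℂ
  | 0, _ => ContinuousMultilinearMap.apply ℂ (fun _ : Fin 0 => X) ℂ 0
  | n + 1, z =>
      (z 0).comp ((ContinuousLinearMap.compL ℂ X _ ℂ (arens n (Fin.tail z))).comp
        (continuousMultilinearCurryLeftEquiv ℂ (fun _ : Fin (n + 1) => X) ℂ
          ).toContinuousLinearEquiv.toContinuousLinearMap)

variable (X) in
/-- Continuous polynomials on `X`: finite sums of continuous homogeneous polynomials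
`x ↦ A (x, …, x)`, each given by its symmetric continuous multilinear form `A`. Only the forms of
order at most `degree` are used, and `degree` need not be sharp. -/
structure Poly where
  degree : ℕ
  form : (n : ℕ) → ContinuousMultilinearMap ℂ (fun _ : Fin n => X) ℂ
  symm : ∀ n (σ : Equiv.Perm (Fin n)) (v : Fin n → X), form n (fun i => v (σ i)) = form n v

/-- The value `P(x)`. -/
def Poly.eval (P : Poly X) (x : X) : ℂ :=
  ∑ n ∈ Finset.range (P.degree + 1), P.form n (fun _ => x)

/-- The Aron-Berner extension `P̃` of `P` to the bidual: the Arens extensions of the symmetric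
forms, restricted to the diagonal. -/
def Poly.aronBerner (P : Poly X) (z : StrongDual ℂ (StrongDual ℂ X)) : ℂ :=
  ∑ n ∈ Finset.range (P.degree + 1), arens n (fun _ => z) (P.form n)

/-- The Aron-Berner extension of `f`, holomorphic on `B`, to the open unit ball of the bidual:
the sum of the Aron-Berner extensions of the terms of the Taylor series of `f` at `0`. -/
def aronBerner (f : UnitBall X → ℂ) (z : StrongDual ℂ (StrongDual ℂ X)) : ℂ :=
  ∑' n : ℕ, ((n.factorial : ℂ))⁻¹ * arens n (fun _ => z) (iteratedFDeriv ℂ n (onSpace f) 0)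

/-- `δ_z (g)` for `g ∈ A_u(B)` and `z` in the closed unit ball of the bidual: the value at `z` of
the continuous extension of the Aron-Berner extension of `g`. The latter is uniformly continuous
on the open unit ball of the bidual, so the value at `z` is the radial limit. -/
def deltaAu (g : UnitBall X → ℂ) (z : StrongDual ℂ (StrongDual ℂ X)) : ℂ :=
  Filter.limUnder (𝓝[<] (1 : ℝ)) fun r => aronBerner g ((r : ℂ) • z)

/-- The polynomial fiber over `z`: the characters of `H` whose restriction to `A_u(B)` is `δ_z`. -/
def polyFiber (H : Subalgebra ℂ (UnitBall X →ᵇ ℂ)) (hH : Au X ≤ H)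
    (z : StrongDual ℂ (StrongDual ℂ X)) : Set (WeakDual.characterSpace ℂ H) :=
  {τ | ∀ g : Au X, τ (Subalgebra.inclusion hH g) = deltaAu (g : UnitBall X →ᵇ ℂ) z}

/-- The polynomial cluster set of `f` at `z`: the limits of `f` along nets (here: proper filters)
in `B` along which `P` tends to `P̃(z)` for every continuous polynomial `P`. -/
def polyCluster (f : UnitBall X → ℂ) (z : StrongDual ℂ (StrongDual ℂ X)) : Set ℂ :=
  {c | ∃ l : Filter (UnitBall X), l.NeBot ∧
    (∀ P : Poly X, Filter.Tendsto (fun y : UnitBall X => P.eval y.1) l (𝓝 (P.aronBerner z))) ∧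
    Filter.Tendsto f l (𝓝 c)}

/-- The polynomial cluster value theorem for `H` at `z`. -/
def PolyClusterValueTheorem (H : Subalgebra ℂ (UnitBall X →ᵇ ℂ)) (hH : Au X ≤ H)
    (z : StrongDual ℂ (StrongDual ℂ X)) : Prop :=
  ∀ f : H, polyCluster (f : UnitBall X →ᵇ ℂ) z =
    WeakDual.gelfandTransform ℂ H f '' polyFiber H hH z

end AronBerner

end PolyCVP

end

/-!
Every `f ∈ A_∞(B)` has a limit along the filter of norm approach to `x` from within `B`, and the
value of this limit is a character of `H`. For `g ∈ A_u(B)` it agrees with `δ_x (g)`: the Taylor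
series of `g` at `0` converges to `g` on all of `B` (restrict to complex lines), and the
Aron-Berner extension of a polynomial restricts to the polynomial on `X`
(`tendsto_aronBerner_smul`). So the fiber over `x` contains evaluation at `x`.

Let `g` be the peak function. If `k ∈ H` tends to `0` at `x`, then `k * g ^ n → 0` uniformly on `B`:
near `x` the factor `k` is small and `|g| ≤ 1`, and away from `x` the powers of `g` tend to `0`
uniformly (`tendsto_mul_pow_of_peak`). A character `τ` in the fiber has `τ g = 1`, so
`τ k = τ (k * g ^ n) → 0`. Hence `τ` is evaluation at `x`.

For the cluster sets, members of `A_u(B)` are uniform limits on `B` of continuous polynomials: dilate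
slightly, then truncate the Taylor series, whose terms obey the Cauchy estimates
(`exists_poly_approx`). Therefore `g → 1` along any filter on `B` on which `P → P̃(x)` for all
polynomials `P`; as `g` peaks strongly at `x`, such a filter converges to `x` in norm, and every
`f ∈ H` has its boundary value at `x` as the only cluster value.
-/

noncomputable section

namespace PolyCVP

open Filter Metric

/-! ### Aron-Berner extensions at points of the space -/

section Taylor

variable {X : Type*} [NormedAddCommGroup X] [NormedSpace ℂ X]

theorem arens_inclusion (n : ℕ) (v : Fin n → X)
    (A : ContinuousMultilinearMap ℂ (fun _ : Fin n => X) ℂ) :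
    arens n (fun i => NormedSpace.inclusionInDoubleDual ℂ X (v i)) A = A v := by
  induction n with
  | zero =>
    simp only [arens, ContinuousMultilinearMap.apply_apply]
    congr 1
    exact Subsingleton.elim _ _
  | succ n ih =>
    have h : (Fin.tail fun i => NormedSpace.inclusionInDoubleDual ℂ X (v i)) =
        fun i => NormedSpace.inclusionInDoubleDual ℂ X (Fin.tail v i) := rfl
    simp only [arens, h, ContinuousLinearMap.comp_apply, NormedSpace.dual_def]
    refine (ih (Fin.tail v) _).trans ?_
    change A (Fin.cons (v 0) (Fin.tail v)) = A v
    rw [Fin.cons_self_tail]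

theorem Poly.aronBerner_inclusion (P : Poly X) (y : X) :
    P.aronBerner (NormedSpace.inclusionInDoubleDual ℂ X y) = P.eval y :=
  Finset.sum_congr rfl fun n _ => arens_inclusion n (fun _ => y) (P.form n)

theorem Poly.continuous_eval (P : Poly X) : Continuous P.eval :=
  continuous_finsetSum _ fun n _ => (P.form n).cont.comp (continuous_pi fun _ => continuous_id)

/-- Restriction to the complex line through `y` identifies directional Taylor coefficients with
those of a function of one variable. -/
theorem iteratedDeriv_comp_smul {f : X → ℂ} (hf : AnalyticAt ℂ f 0) (y : X) (n : ℕ) :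
    iteratedDeriv n (fun z : ℂ => f (z • y)) 0 = iteratedFDeriv ℂ n f 0 (fun _ => y) := by
  obtain ⟨p, r, hp⟩ := hf
  let u : ℂ →L[ℂ] X := (ContinuousLinearMap.id ℂ ℂ).smulRight y
  have hp0 : HasFPowerSeriesOnBall f p (u 0) r := by simpa using hp
  have h := (hp0.compContinuousLinearMap).factorial_smul (1 : ℂ) n
  rw [iteratedDeriv_eq_iteratedFDeriv, ← hp.factorial_smul y n]
  refine Eq.trans h.symm ?_
  congr 1
  change p n (fun _ => u 1) = p n (fun _ => y)
  simp [u]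

variable {f : UnitBall X → ℂ}

/-- The value at `y` of the `n`-th homogeneous term of the Taylor series of `f` at `0`. -/
def taylorTerm (f : UnitBall X → ℂ) (n : ℕ) (y : X) : ℂ :=
  (n.factorial : ℂ)⁻¹ * iteratedFDeriv ℂ n (onSpace f) 0 (fun _ => y)

theorem taylorTerm_smul (f : UnitBall X → ℂ) (n : ℕ) (c : ℂ) (y : X) :
    taylorTerm f n (c • y) = c ^ n * taylorTerm f n y := by
  have h := (iteratedFDeriv ℂ n (onSpace f) 0).map_smul_univ (fun _ => c) (fun _ => y)
  simp only [Finset.prod_const, Finset.card_univ, Fintype.card_fin, smul_eq_mul] at h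
  rw [taylorTerm, h, taylorTerm]
  ring

theorem IsHolo.analyticAt_zero (hf : IsHolo f) : AnalyticAt ℂ (onSpace f) 0 :=
  hf 0 (mem_ball_self one_pos)

/-- The line through a point of `B` stays in `B` for a disc of parameters larger than the unit
disc. -/
theorem IsHolo.exists_differentiableOn_line (hf : IsHolo f) (y : UnitBall X) :
    ∃ R : ℝ, 1 < R ∧ (∀ z ∈ ball (0 : ℂ) R, z • y.1 ∈ ball (0 : X) 1) ∧
      DifferentiableOn ℂ (fun z : ℂ => onSpace f (z • y.1)) (ball 0 R) := by
  have hy : ‖y.1‖ < 1 := mem_ball_zero_iff.1 y.2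
  have hy0 := norm_nonneg y.1
  have hmem : ∀ z ∈ ball (0 : ℂ) (2 / (1 + ‖y.1‖)), z • y.1 ∈ ball (0 : X) 1 := fun z hz => by
    rw [mem_ball_zero_iff, lt_div_iff₀ (by positivity)] at hz
    rw [mem_ball_zero_iff, norm_smul]
    nlinarith [norm_nonneg z]
  refine ⟨2 / (1 + ‖y.1‖), by rw [lt_div_iff₀ (by positivity)]; linarith, hmem, fun z hz => ?_⟩
  exact ((hf _ (hmem z hz)).differentiableAt.comp z
    (differentiableAt_id.smul_const y.1)).differentiableWithinAt

theorem IsHolo.hasSum_taylorTerm (hf : IsHolo f) (y : UnitBall X) :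
    HasSum (fun n => taylorTerm f n y.1) (f y) := by
  obtain ⟨R, hR, -, hd⟩ := hf.exists_differentiableOn_line y
  have h := Complex.hasSum_taylorSeries_on_ball hd (z := 1) (by simpa using hR)
  simpa [iteratedDeriv_comp_smul hf.analyticAt_zero, onSpace_apply, taylorTerm] using h

/-- Cauchy estimates for the Taylor terms on `B`. -/
theorem IsHolo.norm_taylorTerm_le (hf : IsHolo f) {C : ℝ} (hC : ∀ y, ‖f y‖ ≤ C) (n : ℕ)
    (y : UnitBall X) : ‖taylorTerm f n y.1‖ ≤ C := by
  obtain ⟨R, hR, hmem, hd⟩ := hf.exists_differentiableOn_line y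
  have hsub : closedBall (0 : ℂ) 1 ⊆ ball 0 R := closedBall_subset_ball hR
  have h := Complex.norm_iteratedDeriv_le_of_forall_mem_sphere_norm_le (C := C) n one_pos
    (hd.diffContOnCl_ball hsub) fun z hz => by
      have hz' := hmem z (hsub (sphere_subset_closedBall hz))
      rw [onSpace_apply f ⟨_, hz'⟩]
      exact hC _
  rw [iteratedDeriv_comp_smul hf.analyticAt_zero, one_pow, div_one] at h
  rw [taylorTerm, norm_mul, norm_inv, Complex.norm_natCast, inv_mul_le_iff₀ (by positivity)]
  exact h

theorem IsHolo.aronBerner_inclusion (hf : IsHolo f) (y : UnitBall X) :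
    aronBerner f (NormedSpace.inclusionInDoubleDual ℂ X y.1) = f y := by
  rw [aronBerner, ← (hf.hasSum_taylorTerm y).tsum_eq]
  refine tsum_congr fun n => ?_
  rw [arens_inclusion n (fun _ => y.1), taylorTerm]

/-! ### Uniform approximation by polynomials -/

/-- The Taylor polynomial of degree `N` of the dilation `y ↦ f (c • y)`. -/
def dilatedTaylorPoly (hf : IsHolo f) (c : ℂ) (N : ℕ) : Poly X where
  degree := N
  form n := (c ^ n * (n.factorial : ℂ)⁻¹) • iteratedFDeriv ℂ n (onSpace f) 0
  symm n σ v := by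
    have h := (hf.analyticAt_zero.contDiffAt (n := ⊤)).iteratedFDeriv_comp_perm v σ
    simp only [smul_apply]
    exact congrArg _ h

theorem eval_dilatedTaylorPoly (hf : IsHolo f) (c : ℂ) (N : ℕ) (y : X) :
    (dilatedTaylorPoly hf c N).eval y =
      ∑ n ∈ Finset.range (N + 1), taylorTerm f n (c • y) := by
  refine Finset.sum_congr rfl fun n _ => ?_
  rw [taylorTerm_smul]
  simp only [dilatedTaylorPoly, smul_apply, smul_eq_mul, taylorTerm]
  ring

/-- Continuous polynomials are uniformly dense in `A_u(B)`. -/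
theorem exists_poly_approx {g : UnitBall X →ᵇ ℂ} (hg : g ∈ Au X) {ε : ℝ} (hε : 0 < ε) :
    ∃ P : Poly X, ∀ y : UnitBall X, ‖P.eval y.1 - g y‖ < ε := by
  obtain ⟨hol, huc⟩ := hg
  obtain ⟨δ, hδ, hclose⟩ := Metric.uniformContinuous_iff.1 huc (ε / 2) (half_pos hε)
  obtain ⟨r, hr, hr1⟩ := exists_between (max_lt one_pos (sub_lt_self (1 : ℝ) hδ))
  have hr0 : 0 < r := (le_max_left _ _).trans_lt hr
  have hrδ : 1 - r < δ := by linarith [(le_max_right 0 (1 - δ)).trans_lt hr]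
  have hlim : Tendsto (fun N : ℕ => ‖g‖ * r ^ (N + 1) / (1 - r)) atTop (𝓝 0) := by
    have h := ((tendsto_pow_atTop_nhds_zero_of_lt_one hr0.le hr1).comp
      (tendsto_add_atTop_nat 1)).const_mul ‖g‖ |>.div_const (1 - r)
    simpa using h
  obtain ⟨N, hN⟩ := (hlim.eventually (gt_mem_nhds (half_pos hε))).exists
  refine ⟨dilatedTaylorPoly hol (r : ℂ) N, fun y => ?_⟩
  have hy : ‖y.1‖ < 1 := mem_ball_zero_iff.1 y.2
  have hnr : ‖(r : ℂ)‖ = r := by simp [abs_of_pos hr0]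
  have hmem : (r : ℂ) • y.1 ∈ ball (0 : X) 1 := by
    rw [mem_ball_zero_iff, norm_smul, hnr]
    nlinarith [norm_nonneg y.1]
  have h1 : ‖(dilatedTaylorPoly hol (r : ℂ) N).eval y.1 - g ⟨_, hmem⟩‖ < ε / 2 := by
    rw [eval_dilatedTaylorPoly]
    refine (norm_sub_le_of_geometric_bound_of_hasSum hr1 (fun n => ?_)
      (hol.hasSum_taylorTerm ⟨_, hmem⟩) (N + 1)).trans_lt hN
    rw [taylorTerm_smul, norm_mul, norm_pow, hnr, mul_comm]
    gcongr
    exact hol.norm_taylorTerm_le g.norm_coe_le_norm n y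
  have h2 : ‖g ⟨_, hmem⟩ - g y‖ < ε / 2 := by
    rw [← dist_eq_norm]
    refine hclose ?_
    rw [Subtype.dist_eq, dist_eq_norm]
    have : (r : ℂ) • y.1 - y.1 = ((r - 1 : ℝ) : ℂ) • y.1 := by push_cast; module
    rw [this, norm_smul, Complex.norm_real, Real.norm_eq_abs, abs_of_neg (by linarith)]
    nlinarith [norm_nonneg y.1]
  calc _ ≤ _ := norm_sub_le_norm_sub_add_norm_sub _ (g ⟨_, hmem⟩) _
    _ < ε := by linarith

/-- Convergence of all polynomials along a filter forces convergence of all members of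
`A_u(B)`. -/
theorem tendsto_of_tendsto_poly {g : UnitBall X →ᵇ ℂ} (hg : g ∈ Au X) {l l' : Filter (UnitBall X)}
    [l'.NeBot] {a : ℂ} {x : X} (hga : Tendsto g l' (𝓝 a))
    (hx : Tendsto Subtype.val l' (𝓝 x))
    (hl : ∀ P : Poly X, Tendsto (fun y : UnitBall X => P.eval y.1) l (𝓝 (P.eval x))) :
    Tendsto g l (𝓝 a) := by
  rw [Metric.tendsto_nhds]
  intro ε hε
  obtain ⟨P, hP⟩ := exists_poly_approx hg (ε := ε / 3) (by positivity)
  have hPa : ‖P.eval x - a‖ ≤ ε / 3 :=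
    le_of_tendsto (((P.continuous_eval.tendsto x).comp hx).sub hga).norm
      (Eventually.of_forall fun y => (hP y).le)
  filter_upwards [Metric.tendsto_nhds.1 (hl P) (ε / 3) (by positivity)] with y hy
  rw [dist_eq_norm] at hy ⊢
  have h := hP y
  rw [norm_sub_rev] at h
  have e : g y - a = (g y - P.eval y.1) + (P.eval y.1 - P.eval x) + (P.eval x - a) := by ring
  rw [e]
  refine norm_add₃_le.trans_lt ?_
  linarith

end Taylor

/-! ### Boundary values -/

section Boundary

variable {X : Type*} [NormedAddCommGroup X]

/-- The filter of norm approach to `x` from within the open ball. -/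
def approach (x : ClosedUnitBall X) : Filter (UnitBall X) := comap UnitBall.toClosed (𝓝 x)

theorem tendsto_approach_iff {ι : Type*} {l : Filter ι} {u : ι → UnitBall X}
    {x : ClosedUnitBall X} :
    Tendsto u l (approach x) ↔ Tendsto (fun i => (u i).1) l (𝓝 x.1) := by
  rw [approach, tendsto_comap_iff, tendsto_subtype_rng]
  rfl

theorem tendsto_val_approach (x : ClosedUnitBall X) :
    Tendsto Subtype.val (approach x) (𝓝 x.1) :=
  tendsto_approach_iff.1 tendsto_id

variable [NormedSpace ℂ X]

theorem smul_mem_ball (x : ClosedUnitBall X) {r : ℝ} (h0 : 0 ≤ r) (h1 : r < 1) :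
    (r : ℂ) • x.1 ∈ ball (0 : X) 1 := by
  have hx : ‖x.1‖ ≤ 1 := mem_closedBall_zero_iff.1 x.2
  rw [mem_ball_zero_iff, norm_smul, Complex.norm_real, Real.norm_of_nonneg h0]
  nlinarith [norm_nonneg x.1]

/-- The radial path `r ↦ r x`, sent to `0` for the irrelevant parameters outside `[0, 1)`. -/
def radial (x : ClosedUnitBall X) (r : ℝ) : UnitBall X :=
  if h : 0 ≤ r ∧ r < 1 then ⟨(r : ℂ) • x.1, smul_mem_ball x h.1 h.2⟩ else ⟨0, by simp⟩

theorem eventually_radial (x : ClosedUnitBall X) :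
    ∀ᶠ r in 𝓝[<] (1 : ℝ), (radial x r).1 = (r : ℂ) • x.1 := by
  filter_upwards [Ioo_mem_nhdsLT (zero_lt_one (α := ℝ))] with r hr
  rw [radial, dif_pos ⟨hr.1.le, hr.2⟩]

theorem tendsto_radial (x : ClosedUnitBall X) :
    Tendsto (radial x) (𝓝[<] (1 : ℝ)) (approach x) := by
  rw [tendsto_approach_iff]
  refine Tendsto.congr' ((eventually_radial x).mono fun r h => h.symm) ?_
  have hc : Continuous fun r : ℝ => (r : ℂ) • x.1 := by fun_prop
  have h : Tendsto (fun r : ℝ => (r : ℂ) • x.1) (𝓝 1) (𝓝 x.1) := by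
    simpa using hc.tendsto 1
  exact h.mono_left nhdsWithin_le_nhds

instance approach_neBot (x : ClosedUnitBall X) : (approach x).NeBot :=
  (tendsto_radial x).neBot

/-- The value at a point of the closed ball of the continuous extension of `f`, as a limit. -/
def boundaryValue (x : ClosedUnitBall X) (f : UnitBall X → ℂ) : ℂ := limUnder (approach x) f

theorem tendsto_boundaryValue (x : ClosedUnitBall X) {f : UnitBall X →ᵇ ℂ} (hf : f ∈ Ainf X) :
    Tendsto f (approach x) (𝓝 (boundaryValue x f)) := by
  obtain ⟨-, F, hF, hFf⟩ := hf
  refine tendsto_nhds_limUnder ⟨F x, ?_⟩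
  exact ((hF.tendsto x).comp tendsto_comap).congr hFf

theorem boundaryValue_eq {x : ClosedUnitBall X} {f : UnitBall X → ℂ} {a : ℂ}
    (h : Tendsto f (approach x) (𝓝 a)) : boundaryValue x f = a := h.limUnder_eq

theorem tendsto_aronBerner_smul {g : UnitBall X → ℂ} (hg : IsHolo g) (x : ClosedUnitBall X)
    {a : ℂ} (ha : Tendsto g (approach x) (𝓝 a)) :
    Tendsto (fun r : ℝ => aronBerner g ((r : ℂ) • NormedSpace.inclusionInDoubleDual ℂ X x.1))
      (𝓝[<] 1) (𝓝 a) := by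
  refine (ha.comp (tendsto_radial x)).congr' ?_
  filter_upwards [eventually_radial x] with r hr
  rw [← map_smul, ← hr, hg.aronBerner_inclusion]
  rfl

theorem deltaAu_inclusion {g : UnitBall X →ᵇ ℂ} (hg : g ∈ Au X) (hg' : g ∈ Ainf X)
    (x : ClosedUnitBall X) :
    deltaAu g (NormedSpace.inclusionInDoubleDual ℂ X x.1) = boundaryValue x g :=
  (tendsto_aronBerner_smul hg.1 x (tendsto_boundaryValue x hg')).limUnder_eq

/-- Evaluation at a point of the closed ball, as a character of a subalgebra of `A_∞(B)`. -/
def evalHom (x : ClosedUnitBall X) (H : Subalgebra ℂ (UnitBall X →ᵇ ℂ)) (hH : H ≤ Ainf X) :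
    H →ₐ[ℂ] ℂ where
  toFun f := boundaryValue x (f : UnitBall X →ᵇ ℂ)
  map_one' := boundaryValue_eq tendsto_const_nhds
  map_mul' f g := boundaryValue_eq
    ((tendsto_boundaryValue x (hH f.2)).mul (tendsto_boundaryValue x (hH g.2)))
  map_zero' := boundaryValue_eq tendsto_const_nhds
  map_add' f g := boundaryValue_eq
    ((tendsto_boundaryValue x (hH f.2)).add (tendsto_boundaryValue x (hH g.2)))
  commutes' _ := boundaryValue_eq tendsto_const_nhds

end Boundary

/-! ### Peak functions -/

section Peak

variable {X : Type*} [NormedAddCommGroup X]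

/-- A strong peak point of the closed ball, expressed by a function on the open ball. -/
theorem IsStrongPeakPoint.exists_peak [NormedSpace ℂ X] {x : ClosedUnitBall X}
    (hx : IsStrongPeakPoint (AuClosed X) x) :
    ∃ g ∈ Au X, Tendsto g (approach x) (𝓝 1) ∧ (∀ y, ‖g y‖ ≤ 1) ∧
      ∀ ε > 0, ∃ δ > 0, ∀ y : UnitBall X, ε < dist x.1 y.1 → ‖g y‖ < 1 - δ := by
  obtain ⟨F, ⟨hF, g, hg, hFg⟩, hF1, hpeak⟩ := hx
  refine ⟨g, hg, ?_, fun y => ?_, fun ε hε => ?_⟩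
  · rw [← hF1]
    exact ((hF.tendsto x).comp tendsto_comap).congr hFg
  · rw [← hFg]
    by_cases h : x = y.toClosed
    · rw [← h, hF1, norm_one]
    · obtain ⟨δ, hδ, hlt⟩ := hpeak _ (half_pos (dist_pos.2 h))
      linarith [hlt _ (half_lt_self (dist_pos.2 h))]
  · obtain ⟨δ, hδ, hlt⟩ := hpeak ε hε
    refine ⟨δ, hδ, fun y hy => ?_⟩
    rw [← hFg]
    exact hlt _ hy

/-- A filter along which a strongly peaking function tends to `1` converges to the peak point. -/
theorem le_approach_of_peak {x : ClosedUnitBall X} {g : UnitBall X →ᵇ ℂ} {l : Filter (UnitBall X)}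
    (hg : Tendsto g l (𝓝 1))
    (hpeak : ∀ ε > 0, ∃ δ > 0, ∀ y : UnitBall X, ε < dist x.1 y.1 → ‖g y‖ < 1 - δ) :
    l ≤ approach x := by
  refine (tendsto_approach_iff (u := id)).2 (Metric.tendsto_nhds.2 fun ε hε => ?_)
  obtain ⟨δ, hδ, hlt⟩ := hpeak (ε / 2) (half_pos hε)
  have h1 : Tendsto (fun y => ‖g y‖) l (𝓝 1) := by simpa using hg.norm
  filter_upwards [h1.eventually (lt_mem_nhds (sub_lt_self (1 : ℝ) hδ))] with y hy
  by_contra! hfar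
  rw [dist_comm] at hfar
  exact (hlt y ((half_lt_self hε).trans_le hfar)).not_gt hy

/-- Powers of a strongly peaking function uniformly annihilate functions that vanish at the peak
point. -/
theorem tendsto_mul_pow_of_peak {x : ClosedUnitBall X} {k g : UnitBall X →ᵇ ℂ}
    (hk : Tendsto k (approach x) (𝓝 0)) (hg1 : ∀ y, ‖g y‖ ≤ 1)
    (hpeak : ∀ ε > 0, ∃ δ > 0, ∀ y : UnitBall X, ε < dist x.1 y.1 → ‖g y‖ < 1 - δ) :
    Tendsto (fun n : ℕ => k * g ^ n) atTop (𝓝 0) := by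
  rw [Metric.tendsto_nhds]
  intro η hη
  have hbasis : (approach x).HasBasis (fun ε : ℝ => 0 < ε)
      fun ε => UnitBall.toClosed ⁻¹' ball x ε := nhds_basis_ball.comap _
  obtain ⟨ε, hε, hnear⟩ := hbasis.eventually_iff.1
    (Metric.tendsto_nhds.1 hk (η / 2) (half_pos hη))
  obtain ⟨δ, hδ, hfar⟩ := hpeak (ε / 2) (half_pos hε)
  have hq1 : max 0 (1 - δ) < 1 := max_lt one_pos (sub_lt_self _ hδ)
  have hlim : Tendsto (fun n : ℕ => ‖k‖ * max 0 (1 - δ) ^ n) atTop (𝓝 0) := by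
    simpa using (tendsto_pow_atTop_nhds_zero_of_lt_one (le_max_left _ _) hq1).const_mul ‖k‖
  filter_upwards [hlim.eventually (gt_mem_nhds (half_pos hη))] with n hn
  rw [dist_zero_right]
  refine lt_of_le_of_lt ?_ (half_lt_self hη)
  refine (BoundedContinuousFunction.norm_le (half_pos hη).le).2 fun y => ?_
  rw [BoundedContinuousFunction.mul_apply, BoundedContinuousFunction.pow_apply, norm_mul, norm_pow]
  by_cases hy : dist x.1 y.1 < ε
  · have h := hnear (x := y) (by
      rw [Set.mem_preimage, mem_ball, dist_comm]
      exact hy)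
    rw [dist_zero_right] at h
    calc _ ≤ ‖k y‖ * 1 := by
          gcongr
          exact pow_le_one₀ (norm_nonneg _) (hg1 y)
      _ ≤ η / 2 := by linarith
  · have h := hfar y ((half_lt_self hε).trans_le (not_lt.1 hy))
    refine le_trans ?_ hn.le
    gcongr
    · exact k.norm_coe_le_norm y
    · exact h.le.trans (le_max_right _ _)

end Peak

end PolyCVP

end

open PolyCVP Filter in
theorem corollary4p9 {X : Type*} [NormedAddCommGroup X] [NormedSpace ℂ X] [CompleteSpace X]
    (x : PolyCVP.ClosedUnitBall X)
    (hx : PolyCVP.IsStrongPeakPoint (PolyCVP.AuClosed X) x)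
    (H : Subalgebra ℂ (PolyCVP.UnitBall X →ᵇ ℂ))
    (hclosed : IsClosed (H : Set (PolyCVP.UnitBall X →ᵇ ℂ)))
    (hAu : PolyCVP.Au X ≤ H) (hAinf : H ≤ PolyCVP.Ainf X) :
    (∃ τ, PolyCVP.polyFiber H hAu (NormedSpace.inclusionInDoubleDual ℂ X x.1) = {τ}) ∧
      PolyCVP.PolyClusterValueTheorem H hAu (NormedSpace.inclusionInDoubleDual ℂ X x.1) := by
  obtain ⟨g, hg, hgx, hg1, hpeak⟩ := hx.exists_peak
  -- Algebra homomorphisms into `ℂ` are continuous because `H` is a Banach algebra.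
  have : CompleteSpace H := hclosed.completeSpace_coe
  let τ₀ : WeakDual.characterSpace ℂ H :=
    WeakDual.CharacterSpace.equivAlgHom.symm (evalHom x H hAinf)
  have hτ₀ : ∀ f : H, τ₀ f = boundaryValue x (f : UnitBall X →ᵇ ℂ) := fun f => rfl
  have hfiber : polyFiber H hAu (NormedSpace.inclusionInDoubleDual ℂ X x.1) = {τ₀} := by
    refine Set.eq_singleton_iff_unique_mem.2 ⟨fun u => ?_, fun τ hτ => ?_⟩
    · rw [deltaAu_inclusion u.2 (hAinf (hAu u.2)), hτ₀]
      rfl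
    · have hτg : τ ⟨g, hAu hg⟩ = 1 := by
        have h := hτ ⟨g, hg⟩
        rw [deltaAu_inclusion hg (hAinf (hAu hg)), boundaryValue_eq hgx] at h
        exact h
      refine WeakDual.CharacterSpace.ext fun f => ?_
      rw [hτ₀]
      set c := boundaryValue x (f : UnitBall X →ᵇ ℂ) with hc
      set k : H := f - algebraMap ℂ H c with hkdef
      have hk : Tendsto (k : UnitBall X →ᵇ ℂ) (approach x) (𝓝 0) := by
        have h := (tendsto_boundaryValue x (hAinf f.2)).sub_const c
        rw [← hc, sub_self] at h
        exact h
      have hlim : Tendsto (fun n : ℕ => k * (⟨g, hAu hg⟩ : H) ^ n) atTop (𝓝 0) :=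
        tendsto_subtype_rng.2 (tendsto_mul_pow_of_peak hk hg1 hpeak)
      have hτlim := ((map_continuous τ).tendsto 0).comp hlim
      have hτk : τ k = 0 := by
        refine tendsto_nhds_unique (tendsto_const_nhds (x := τ k) (f := atTop (α := ℕ))) ?_
        rw [map_zero] at hτlim
        refine hτlim.congr fun n => ?_
        rw [Function.comp_apply, map_mul, map_pow, hτg, one_pow, mul_one]
      have h := hτk
      rw [hkdef, map_sub, AlgHomClass.commutes, sub_eq_zero] at h
      exact h
  refine ⟨⟨τ₀, hfiber⟩, fun f => ?_⟩
  rw [hfiber, Set.image_singleton, WeakDual.gelfandTransform_apply_apply, hτ₀]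
  have hf := tendsto_boundaryValue x (hAinf f.2)
  refine Set.eq_singleton_iff_unique_mem.2 ⟨⟨approach x, inferInstance, fun P => ?_, hf⟩, ?_⟩
  · rw [P.aronBerner_inclusion]
    exact (P.continuous_eval.tendsto x.1).comp (tendsto_val_approach x)
  · rintro a ⟨l, hl, hP, ha⟩
    simp only [Poly.aronBerner_inclusion] at hP
    have hgl := tendsto_of_tendsto_poly hg hgx (tendsto_val_approach x) hP
    exact tendsto_nhds_unique ha (hf.mono_left (le_approach_of_peak hgl hpeak))
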